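/- Let $\mathbb R[x]=\mathbb R[x_1,\dots,x_n]$. For $h=(h_1,\dots,h_l)$ with $h_j\in\mathbb R[x]$ let $V(h)=\{x\in\mathbb R^n: h_1(x)=\dots=h_l(x)=0\}$; such sets are called (algebraic) varieties. For a variety $V$: - $I(V)\subset\mathbb R[x]$ is the ideal of polynomials vanishing on $V$; - $V$ is irreducible if it is not the union of two varieties properly contained in $V$ (so $\emptyset$ is irreducible); the irreducible components of $V$ are the irreducible varieties $V_1,\dots,V_r$ ($r\ge 1$) with $V=V_1\cup\dots\cup V_r$ and $V_j\not\subset V_t$ for $j\ne t$ (for $V=\emptyset$: $r=1$, $V_1=\emptyset$); - $\dim V$ is the largest $k$ such that $V$ is a $k$-dimensional smooth submanifold of $\mathbb R^n$ near one of its points, and $\dim\emptyset=0$; - if $h_1,\dots,h_l$ generate $I(V)$, the singular locus $V^{\mathrm{sing}}$ is the set of $a\in V$ at which the Jacobian matrix $\big(\frac{\partial h_j}{\partial x_t}(a)\big)_{t,j}$ does not have rank $n-\dim V$. Given a variety $V$, consider the following algorithm. 1. Set $U:=V$, $A:=\emptyset$, $B:=\emptyset$. 2. Let $U_1,\dots,U_r$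 be the irreducible components of $U$. 3. Set $A:=A\cup\{U_1,\dots,U_r\}$. 4. For $j=1,\dots,r$: (a) if $\dim U_j=0$, set $A:=A\setminus\{U_j\}$ and $B:=B\cup\{U_j\}$; (b) otherwise run Steps 2, 3, 4 recursively with $U:=U_j^{\mathrm{sing}}$ (and the current $A$, $B$). The output is the final pair $A,B$ of sets of subvarieties of $V$. **Theorem.** Let $h_0,h_1,\dots,h_l\in\mathbb R[x]$ and $h=(h_1,\dots,h_l)$, and let $x^\star$ be a global minimizer of $h_0$ on $V(h)$. Then the algorithm with input $V=V(h)$ terminates, and for its output $A,B$ at least one of the following holds: 1. there is a variety $U\in A$ such that for any generators $q_1,\dots,q_r$ of $I(U)$, with $q=(q_1,\dots,q_r)$ (so that $V(q)=U$), $x^\star$ is a global minimizer for the problem $\min_{x\in V(q)}h_0(x)$ and the Karush--Kuhn--Tucker conditions hold for it at $x^\star$, i.e. $q_j(x^\star)=0$ for all $j$ and there are $\lambda_1^\star,\dots,\lambda_r^\star\in\mathbb R$ with $\nabla h_0(x^\star)=\sum_{j=1}^r\lambda_j^\star\nabla q_j(x^\star)$; 2. there is a zero-dimensional variety $U\in B$,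 defined by some $q=(q_1,\dots,q_r)$ with $q_j\in\mathbb R[x]$ (that is, $U=V(q)$), such that $x^\star$ is a global minimizer for the problem $\min_{x\in V(q)}h_0(x)$. -/

import Mathlib

open scoped ContDiff

namespace RealVariety

/-- The real algebraic variety `V(h)` in `ℝⁿ` defined by the vector `h = (h₁, …, h_l)`. -/
def zeroSet {n l : ℕ} (h : Fin l → MvPolynomial (Fin n) ℝ) : Set (Fin n → ℝ) :=
  {x | ∀ j, MvPolynomial.eval x (h j) = 0}

/-- `V` is an algebraic variety in `ℝⁿ`. -/
def IsVariety {n : ℕ} (V : Set (Fin n → ℝ)) : Prop :=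
  ∃ (l : ℕ) (h : Fin l → MvPolynomial (Fin n) ℝ), V = zeroSet h

/-- `h₁, …, h_l` generate the vanishing ideal `I(V)`. -/
def Generates {n l : ℕ} (h : Fin l → MvPolynomial (Fin n) ℝ) (V : Set (Fin n → ℝ)) : Prop :=
  Ideal.span (Set.range h) = MvPolynomial.vanishingIdeal ℝ V

/-- A variety is irreducible if it is not the union of two proper subvarieties. With this
convention the empty variety is irreducible. -/
def IsIrred {n : ℕ} (V : Set (Fin n → ℝ)) : Prop :=
  IsVariety V ∧ ∀ V₁ V₂ : Set (Fin n → ℝ), IsVariety V₁ → IsVariety V₂ →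
    V = V₁ ∪ V₂ → V₁ = V ∨ V₂ = V

/-- `C = [V₁, …, V_r]`, `r ≥ 1`, lists the irreducible components of `V`: each `V_j` is
irreducible, `V = V₁ ∪ ⋯ ∪ V_r`, and `V_j ⊄ V_t` for `j ≠ t`. The list of components of the
empty variety is `[∅]`. -/
def IsComponents {n : ℕ} (V : Set (Fin n → ℝ)) (C : List (Set (Fin n → ℝ))) : Prop :=
  C ≠ [] ∧ (∀ W ∈ C, IsIrred W) ∧ V = {x | ∃ W ∈ C, x ∈ W} ∧
    C.Pairwise (fun X Y => ¬ X ⊆ Y ∧ ¬ Y ⊆ X)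

/-- `V` is a smooth `k`-dimensional submanifold of `ℝⁿ` at `a`: on an open neighbourhood `W`
of `a` it is the zero set of a smooth map to `ℝ^(n-k)` that is submersive at `a`. -/
def IsSubmanifoldAt {n : ℕ} (V : Set (Fin n → ℝ)) (a : Fin n → ℝ) (k : ℕ) : Prop :=
  a ∈ V ∧ ∃ (m : ℕ) (W : Set (Fin n → ℝ)) (g : (Fin n → ℝ) → (Fin m → ℝ)),
    m + k = n ∧ IsOpen W ∧ a ∈ W ∧ ContDiffOn ℝ ∞ g W ∧
    Function.Surjective (fderiv ℝ g a) ∧ V ∩ W = {x ∈ W | g x = 0}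

/-- The dimension of `V`: the highest `k` such that `V` is a `k`-dimensional submanifold at
some point. The set is bounded by `n`; the convention `dim ∅ = 0` is `sSup ∅ = 0` in `ℕ`. -/
noncomputable def dim {n : ℕ} (V : Set (Fin n → ℝ)) : ℕ :=
  sSup {k | ∃ a, IsSubmanifoldAt V a k}

/-- The Jacobian matrix `J(h)(x) = (∂h_j/∂x_t (x))_{t,j}`. -/
noncomputable def jacobian {n l : ℕ} (h : Fin l → MvPolynomial (Fin n) ℝ) (x : Fin n → ℝ) :
    Matrix (Fin n) (Fin l) ℝ :=
  Matrix.of fun t j => MvPolynomial.eval x (MvPolynomial.pderiv t (h j))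

/-- The regular locus: the points `a` of `V` where `J(h)(a)` has rank `n - dim V` for generators
`h` of `I(V)` (the rank at a point of `V` does not depend on the generators). -/
def regularLocus {n : ℕ} (V : Set (Fin n → ℝ)) : Set (Fin n → ℝ) :=
  {a ∈ V | ∃ (l : ℕ) (h : Fin l → MvPolynomial (Fin n) ℝ),
    Generates h V ∧ (jacobian h a).rank + dim V = n}

/-- The singular locus `V \ V^reg`. -/
def singularLocus {n : ℕ} (V : Set (Fin n → ℝ)) : Set (Fin n → ℝ) :=
  V \ regularLocus V

/-- Step 4 of the decomposition algorithm, as a big-step relation: `Loop L A B A' B'` says that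
treating the varieties in the list `L` in order, starting from the sets `A` and `B`,
terminates with the sets `A'` and `B'`. A zero-dimensional variety is moved from `A` to `B`. For
any other variety `U`, the components of the singular locus of `U` are added to `A` and are
treated in turn (with the current `A` and `B`) before the rest of the list. -/
inductive Loop {n : ℕ} : List (Set (Fin n → ℝ)) →
    Set (Set (Fin n → ℝ)) → Set (Set (Fin n → ℝ)) →
    Set (Set (Fin n → ℝ)) → Set (Set (Fin n → ℝ)) → Prop
  | nil (A B : Set (Set (Fin n → ℝ))) : Loop [] A B A B
  | zeroDim (U : Set (Fin n → ℝ)) (L : List (Set (Fin n → ℝ)))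
      (A B A' B' : Set (Set (Fin n → ℝ))) :
      dim U = 0 → Loop L (A \ {U}) (B ∪ {U}) A' B' → Loop (U :: L) A B A' B'
  | posDim (U : Set (Fin n → ℝ)) (L C : List (Set (Fin n → ℝ)))
      (A B A₁ B₁ A' B' : Set (Set (Fin n → ℝ))) :
      dim U ≠ 0 → IsComponents (singularLocus U) C →
      Loop C (A ∪ {W | W ∈ C}) B A₁ B₁ → Loop L A₁ B₁ A' B' → Loop (U :: L) A B A' B'

/-- The decomposition algorithm with input `V` terminates with output `A`, `B`. -/
def IsOutput {n : ℕ} (V : Set (Fin n → ℝ)) (A B : Set (Set (Fin n → ℝ))) : Prop :=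
  ∃ C : List (Set (Fin n → ℝ)), IsComponents V C ∧ Loop C {W | W ∈ C} ∅ A B

/-- `x` is a global minimizer for the problem `min_{y ∈ V(q)} f(y)`. -/
def IsGlobalMinimizer {n r : ℕ} (f : MvPolynomial (Fin n) ℝ)
    (q : Fin r → MvPolynomial (Fin n) ℝ) (x : Fin n → ℝ) : Prop :=
  x ∈ zeroSet q ∧ ∀ y ∈ zeroSet q, MvPolynomial.eval x f ≤ MvPolynomial.eval y f

/-- The Karush--Kuhn--Tucker conditions hold for the problem `min_{y ∈ V(q)} f(y)` at `x`. -/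
def KKT {n r : ℕ} (f : MvPolynomial (Fin n) ℝ)
    (q : Fin r → MvPolynomial (Fin n) ℝ) (x : Fin n → ℝ) : Prop :=
  ∃ lam : Fin r → ℝ, (∀ j, MvPolynomial.eval x (q j) = 0) ∧
    ∀ t : Fin n, MvPolynomial.eval x (MvPolynomial.pderiv t f) =
      ∑ j, lam j * MvPolynomial.eval x (MvPolynomial.pderiv t (q j))

end RealVariety

/-! Write `N_a` for the span of the gradients at `a` of all polynomials in `I(V)`; the Jacobian of
any generators has rank `dim N_a`. For a nonempty irreducible `V` the heart of the matter is that
`dim N_a + dim V ≤ n` on all of `V`, with equality at some point. Since `dim V` is defined through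
submanifold charts, this compares analysis with algebra, in two directions.

If `V` is a `k`-dimensional submanifold near `b`, some `k` coordinates are algebraically independent
modulo the prime ideal `I(V)` (`exists_independent_coordinates`). The dual derivations of the
function field then give `k` independent vectors in the kernel of the Jacobian at the generic point,
so no `n - k + 1` gradients are independent anywhere on `V` (`card_add_le_of_gram_notMem`).

Conversely, let `dim N_a = r` be maximal on `V`, and let `g₁, …, g_r ∈ I(V)` have independent
gradients at `a`. Along a curve from `a` inside `g = 0`, the values of the generators of `I(V)`
solve a homogeneous linear ODE with zero initial value, so they vanish. Hence `V` is `g = 0` near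
`a`, a submanifold of dimension `n - r` (`exists_isOpen_mem_of_eval_eq_zero`).

So the singular locus is a proper subvariety, and Lagrange multipliers apply at regular points. The
Hilbert basis theorem makes the recursion terminate. Following the minimizer, it is either regular
on the current variety, which gives KKT, or lies on a component of the singular locus and still
minimizes there, until the dimension is zero. -/

open Filter Topology

namespace RealVariety

/-! ### Differential calculus of polynomial functions -/

/-- The gradient of a polynomial at a point. -/
noncomputable def grad {n : ℕ} (f : MvPolynomial (Fin n) ℝ) (x : Fin n → ℝ) : Fin n → ℝ :=
  fun t => MvPolynomial.eval x (MvPolynomial.pderiv t f)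

/-- The differential of a polynomial at a point. -/
noncomputable def differential {n : ℕ} (f : MvPolynomial (Fin n) ℝ) (x : Fin n → ℝ) :
    (Fin n → ℝ) →L[ℝ] ℝ :=
  ∑ t, grad f x t • ContinuousLinearMap.proj t

theorem differential_apply {n : ℕ} (f : MvPolynomial (Fin n) ℝ) (x v : Fin n → ℝ) :
    differential f x v = grad f x ⬝ᵥ v := by
  simp [differential, dotProduct]

theorem hasStrictFDerivAt_eval {n : ℕ} (f : MvPolynomial (Fin n) ℝ) (x : Fin n → ℝ) :
    HasStrictFDerivAt (fun y => MvPolynomial.eval y f) (differential f x) x := by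
  induction f using MvPolynomial.induction_on with
  | C a =>
    have : differential (MvPolynomial.C a) x = 0 := by
      ext v; simp [differential, grad]
    simpa [this] using hasStrictFDerivAt_const a x
  | add p q hp hq =>
    have : differential (p + q) x = differential p x + differential q x := by
      ext v; simp [differential, grad, add_mul, Finset.sum_add_distrib]
    rw [this]
    simp only [map_add]
    exact hp.add hq
  | mul_X p i hp =>
    have hi : HasStrictFDerivAt (fun y : Fin n → ℝ => y i)
        (ContinuousLinearMap.proj (R := ℝ) (φ := fun _ : Fin n => ℝ) i) x :=
      (ContinuousLinearMap.proj (R := ℝ) (φ := fun _ : Fin n => ℝ) i).hasStrictFDerivAt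
    have : differential (p * MvPolynomial.X i) x = MvPolynomial.eval x p •
        ContinuousLinearMap.proj (R := ℝ) (φ := fun _ : Fin n => ℝ) i + x i • differential p x := by
      ext v
      simp only [differential, grad, Derivation.leibniz, MvPolynomial.pderiv_X, smul_eq_mul,
        map_add, map_mul, MvPolynomial.eval_X, sum_apply,
        smul_apply, ContinuousLinearMap.proj_apply,
        add_apply, add_mul, Finset.sum_add_distrib, Finset.mul_sum, mul_assoc]
      congr 1
      rw [← Finset.mul_sum]
      congr 1
      rw [Finset.sum_eq_single i]
      · simp
      · intro j _ hj; simp [hj.symm]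
      · simp
    rw [this]
    simp only [map_mul, MvPolynomial.eval_X]
    exact hp.mul hi

theorem contDiff_eval {n : ℕ} (f : MvPolynomial (Fin n) ℝ) {k : WithTop ℕ∞} :
    ContDiff ℝ k (fun y : Fin n → ℝ => MvPolynomial.eval y f) := by
  induction f using MvPolynomial.induction_on with
  | C a => simpa using contDiff_const
  | add p q hp hq => simpa using hp.add hq
  | mul_X p i hp => simpa using hp.mul (contDiff_apply ℝ ℝ i)

/-! ### Derivations of function fields in characteristic zero -/

/-- Infinitesimal lifting of the identity of `K`. The map `φ` is explicit because for `B = K[ε]` it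
will be twisted by a derivation and differ from the obvious structure map. -/
theorem exists_ringHom_section_of_formallySmooth {A K B : Type} [CommRing A] [CommRing K]
    [CommRing B] [Algebra A K] [Algebra.FormallySmooth A K] (φ : A →+* B) (π : B →+* K)
    (hπ : Function.Surjective π) (hker : RingHom.ker π ^ 2 = ⊥)
    (hφ : ∀ a, π (φ a) = algebraMap A K a) :
    ∃ ψ : K →+* B, (∀ x, π (ψ x) = x) ∧ ∀ a, ψ (algebraMap A K a) = φ a := by
  let : Algebra A B := φ.toAlgebra
  let πA : B →ₐ[A] K := { π with commutes' := hφ }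
  have hn : IsNilpotent (RingHom.ker (πA : B →+* K)) := ⟨2, hker⟩
  refine ⟨(Algebra.FormallySmooth.liftOfSurjective (AlgHom.id A K) πA hπ hn : K →ₐ[A] B), ?_, ?_⟩
  · intro x
    exact Algebra.FormallySmooth.liftOfSurjective_apply (AlgHom.id A K) πA hπ hn x
  · intro a
    exact (Algebra.FormallySmooth.liftOfSurjective (AlgHom.id A K) πA hπ hn).commutes a

/-- A derivation `d` is the same as a ring homomorphism `a ↦ a + ε d(a)` into the dual numbers.
Lifting extends it to a section `K → K[ε]`, whose `ε`-part is `D`. -/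
theorem exists_derivation_of_formallySmooth {k A K : Type} [Field k] [CommRing A] [Field K]
    [Algebra k A] [Algebra k K] [Algebra A K] [IsScalarTower k A K]
    [Algebra.FormallySmooth A K] (d : Derivation k A K) :
    ∃ D : Derivation k K K, ∀ a, D (algebraMap A K a) = d a := by
  let φ : A →+* TrivSqZeroExt K K :=
    { toFun := fun a => TrivSqZeroExt.inl (algebraMap A K a) + TrivSqZeroExt.inr (d a)
      map_one' := by ext <;> simp
      map_zero' := by ext <;> simp
      map_add' := fun a b => by ext <;> simp
      map_mul' := fun a b => by
        ext
        · simp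
        · simp only [Derivation.leibniz, Algebra.smul_def, TrivSqZeroExt.snd_add,
            TrivSqZeroExt.snd_inl, TrivSqZeroExt.snd_inr, TrivSqZeroExt.snd_mul,
            TrivSqZeroExt.fst_add, TrivSqZeroExt.fst_inl, TrivSqZeroExt.fst_inr,
            MulOpposite.smul_eq_mul_unop, MulOpposite.unop_op, Algebra.algebraMap_self,
            RingHom.id_apply]
          ring }
  obtain ⟨ψ, h1, h2⟩ := exists_ringHom_section_of_formallySmooth (A := A) (K := K) φ
    (TrivSqZeroExt.fstHom K K K : TrivSqZeroExt K K →+* K)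
    (fun x => ⟨TrivSqZeroExt.inl x, by simp⟩)
    (by
      rw [eq_bot_iff, pow_two, Ideal.mul_le]
      intro r hr s hs
      simp only [RingHom.mem_ker] at hr hs
      have hr' : r.fst = 0 := hr
      have hs' : s.fst = 0 := hs
      rw [Ideal.mem_bot]
      ext <;> simp [hr', hs'])
    (fun a => by simp [φ])
  have hfst : ∀ x, (ψ x).fst = x := h1
  have hk : ∀ c : k, (ψ (algebraMap k K c)).snd = 0 := by
    intro c
    rw [IsScalarTower.algebraMap_apply k A K, h2]
    simp [φ]
  refine ⟨Derivation.mk' { toFun := fun x => (ψ x).snd, map_add' := by simp, map_smul' := ?_ } ?_,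
    ?_⟩
  · intro c x
    simp [Algebra.smul_def, hk, hfst]
  · intro x y
    simp [hfst, mul_comm]
  · intro a
    simp [h2, φ]

/-- The partial derivative `∂/∂X_t` on `k[ι]` extends to `K`: localization to `k(ι)` is formally
smooth, and so is the field extension `K / k(ι)`, being essentially of finite type in characteristic
zero. -/
theorem exists_derivation_of_algebraicIndependent {k K ι : Type} [Field k] [CharZero k] [Field K]
    [Algebra k K] [Algebra.EssFiniteType k K] [DecidableEq ι] {v : ι → K}
    (hv : AlgebraicIndependent k v) (t : ι) :
    ∃ D : Derivation k K K, ∀ s, D (v s) = if s = t then 1 else 0 := by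
  let : Algebra (MvPolynomial ι k) K := (MvPolynomial.aeval v).toAlgebra
  have : IsScalarTower k (MvPolynomial ι k) K := IsScalarTower.of_algebraMap_eq fun c => by
    change _ = MvPolynomial.aeval v (MvPolynomial.C c)
    simp
  have hinj : Function.Injective (algebraMap (MvPolynomial ι k) K) := hv
  have : FaithfulSMul (MvPolynomial ι k) K := (faithfulSMul_iff_algebraMap_injective _ _).2 hinj
  let F := FractionRing (MvPolynomial ι k)
  let : Algebra F K := FractionRing.liftAlgebra (MvPolynomial ι k) K
  have : IsScalarTower (MvPolynomial ι k) F K := FractionRing.isScalarTower_liftAlgebra _ _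
  have : IsScalarTower k F K := IsScalarTower.of_algebraMap_eq fun c => by
    rw [IsScalarTower.algebraMap_apply k (MvPolynomial ι k) K,
      IsScalarTower.algebraMap_apply (MvPolynomial ι k) F K,
      ← IsScalarTower.algebraMap_apply k (MvPolynomial ι k) F]
  have : CharZero F := charZero_of_injective_algebraMap (algebraMap k F).injective
  have : Algebra.EssFiniteType F K := Algebra.EssFiniteType.of_comp k F K
  have : Algebra.FormallySmooth (MvPolynomial ι k) F :=
    .of_isLocalization (nonZeroDivisors _)
  have : Algebra.FormallySmooth (MvPolynomial ι k) K := .comp _ F _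
  obtain ⟨D, hD⟩ := exists_derivation_of_formallySmooth
    (MvPolynomial.mkDerivation k (fun s : ι => if s = t then (1 : K) else 0))
  refine ⟨D, fun s => ?_⟩
  have h1 : algebraMap (MvPolynomial ι k) K (MvPolynomial.X s) = v s := MvPolynomial.aeval_X v s
  rw [← h1, hD, MvPolynomial.mkDerivation_X]

theorem derivation_aeval {k K σ : Type} [Field k] [Field K] [Algebra k K] [Fintype σ]
    (D : Derivation k K K) (x : σ → K) (p : MvPolynomial σ k) :
    D (MvPolynomial.aeval x p) =
      ∑ i, MvPolynomial.aeval x (MvPolynomial.pderiv i p) * D (x i) := by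
  classical
  induction p using MvPolynomial.induction_on with
  | C a => simp
  | add p q hp hq => simp [hp, hq, add_mul, Finset.sum_add_distrib]
  | mul_X p i hp =>
    simp only [map_mul, MvPolynomial.aeval_X, Derivation.leibniz, smul_eq_mul, hp,
      MvPolynomial.pderiv_X, map_add, add_mul, Finset.sum_add_distrib, Finset.mul_sum]
    congr 1
    · rw [Finset.sum_eq_single i]
      · simp
      · intro j _ hj; simp [hj.symm]
      · simp
    · exact Finset.sum_congr rfl fun _ _ => by ring

/-! ### Rank of the Jacobian at the generic point -/

/-- The matrix whose rows are the gradients of the polynomials `g i`. -/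
noncomputable def gradMatrix {n r : ℕ} (g : Fin r → MvPolynomial (Fin n) ℝ) :
    Matrix (Fin r) (Fin n) (MvPolynomial (Fin n) ℝ) :=
  Matrix.of fun i t => MvPolynomial.pderiv t (g i)

/-- The Gram matrix of the gradients of the polynomials `g i`. -/
noncomputable def gramMatrix {n r : ℕ} (g : Fin r → MvPolynomial (Fin n) ℝ) :
    Matrix (Fin r) (Fin r) (MvPolynomial (Fin n) ℝ) :=
  gradMatrix g * (gradMatrix g).transpose

/-- The generic rank of the Jacobian of elements of a prime ideal is at most the codimension,
measured by algebraically independent coordinates. -/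
theorem card_add_le_of_gram_notMem {n r : ℕ} (I : Ideal (MvPolynomial (Fin n) ℝ)) [I.IsPrime]
    (T : Finset (Fin n))
    (hT : ∀ p : MvPolynomial T ℝ, MvPolynomial.rename (↑) p ∈ I → p = 0)
    (g : Fin r → MvPolynomial (Fin n) ℝ) (hg : ∀ i, g i ∈ I) (hΔ : (gramMatrix g).det ∉ I) :
    T.card + r ≤ n := by
  classical
  let A := MvPolynomial (Fin n) ℝ ⧸ I
  let K := FractionRing A
  have : Algebra.EssFiniteType ℝ K := Algebra.EssFiniteType.comp ℝ A K
  let x : Fin n → K := fun i => algebraMap A K (Ideal.Quotient.mk I (MvPolynomial.X i))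
  -- `x` is the generic point of `V(I)`: a polynomial vanishes at it exactly when it lies in `I`.
  have hx : ∀ p, MvPolynomial.aeval x p = algebraMap A K (Ideal.Quotient.mk I p) := by
    intro p
    have : MvPolynomial.aeval x =
        (IsScalarTower.toAlgHom ℝ A K).comp (Ideal.Quotient.mkₐ ℝ I) := by
      ext i; simp [x]; rfl
    rw [this]; rfl
  have hx0 : ∀ p, MvPolynomial.aeval x p = 0 ↔ p ∈ I := by
    intro p
    rw [hx, FaithfulSMul.algebraMap_eq_zero_iff, Ideal.Quotient.eq_zero_iff_mem]
  have hv : AlgebraicIndependent ℝ (fun t : T => x t) := by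
    rw [algebraicIndependent_iff]
    intro p hp
    apply hT
    rw [← hx0, MvPolynomial.aeval_rename]
    exact hp
  choose D hD using exists_derivation_of_algebraicIndependent hv
  let N : Matrix (Fin r) (Fin n) K := (gradMatrix g).map (MvPolynomial.aeval x)
  have hN : (N * N.transpose).det ≠ 0 := by
    have : N * N.transpose = (gramMatrix g).map (MvPolynomial.aeval x) := by
      rw [gramMatrix, ← AlgHom.coe_toRingHom, Matrix.map_mul, ← Matrix.transpose_map]; rfl
    rw [this]
    have h2 := (AlgHom.map_det (MvPolynomial.aeval x) (gramMatrix g)).symm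
    intro h0
    apply hΔ
    rw [← hx0, ← h0]
    exact h2.symm
  have hrank : r ≤ N.rank := by
    have h1 : (N * N.transpose).rank = r := by
      rw [Matrix.rank_of_isUnit _ ((Matrix.isUnit_iff_isUnit_det _).2 hN.isUnit)]; simp
    exact h1.ge.trans (Matrix.rank_mul_le_left _ _)
  -- By the chain rule applied to `g i (x) = 0`, each vector `(D t (x i))_i` is in the kernel. These
  -- vectors are independent because their coordinates in `T` form the identity matrix.
  have hli : LinearIndependent K
      (fun t : T => (⟨fun i => D t (x i), by
        rw [LinearMap.mem_ker]
        ext i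
        have := derivation_aeval (D t) x (g i)
        rw [(hx0 _).2 (hg i), map_zero] at this
        exact this.symm⟩ : LinearMap.ker N.mulVecLin)) := by
    rw [Fintype.linearIndependent_iff]
    intro c hc t
    have := congrFun (congrArg Subtype.val hc) t
    simpa [hD] using this
  have h1 := hli.fintype_card_le_finrank
  have h2 := N.mulVecLin.finrank_range_add_finrank_ker
  simp only [Module.finrank_fintype_fun_eq_card, Fintype.card_fin, Fintype.card_coe] at h1 h2
  have h3 : N.rank = Module.finrank K (LinearMap.range N.mulVecLin) := rfl
  omega

/-! ### Independent coordinates from a submanifold chart -/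

/-- Choose `m` columns of `L` forming a basis and let `T` index the others: the `T`-coordinates are
free, and the basis columns then correct the value of `L`. -/
theorem exists_coordinates_surjective {n m k : ℕ} (hmk : m + k = n)
    (L : (Fin n → ℝ) →ₗ[ℝ] (Fin m → ℝ)) (hL : Function.Surjective L) :
    ∃ T : Finset (Fin n), T.card = k ∧
      ∀ (u : Fin m → ℝ) (w : T → ℝ), ∃ v, L v = u ∧ ∀ t : T, v t = w t := by
  classical
  let c : Fin n → (Fin m → ℝ) := fun i => L (Pi.single i 1)
  have hLc : ∀ v, L v = ∑ i, v i • c i := fun v => by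
    conv_lhs => rw [pi_eq_sum_univ' v]
    simp only [map_sum, map_smul, c]
  have hspan : Submodule.span ℝ (Set.range c) = ⊤ := by
    rw [eq_top_iff]
    intro u _
    obtain ⟨v, rfl⟩ := hL u
    rw [hLc]
    exact Submodule.sum_mem _ fun i _ =>
      Submodule.smul_mem _ _ (Submodule.subset_span (Set.mem_range_self i))
  obtain ⟨κ, a, ha, haspan, hali⟩ := exists_linearIndependent' ℝ c
  have : Fintype κ := Fintype.ofInjective a ha
  have hκ : Fintype.card κ = m := by
    have := finrank_span_eq_card hali
    rw [haspan, hspan, finrank_top] at this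
    simpa using this.symm
  refine ⟨(Finset.univ.image a)ᶜ, ?_, fun u w => ?_⟩
  · rw [Finset.card_compl, Finset.card_image_of_injective _ ha]
    simp only [Fintype.card_fin, Finset.card_univ, hκ]
    omega
  · let v₀ : Fin n → ℝ := fun i => if h : i ∈ (Finset.univ.image a)ᶜ then w ⟨i, h⟩ else 0
    have hmem : u - L v₀ ∈ Submodule.span ℝ (Set.range (c ∘ a)) := by
      rw [haspan, hspan]; trivial
    obtain ⟨z, hz⟩ := (Submodule.mem_span_range_iff_exists_fun ℝ).1 hmem
    refine ⟨v₀ + ∑ q, z q • Pi.single (a q) 1, ?_, fun t => ?_⟩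
    · have : L (∑ q, z q • Pi.single (a q) 1) = u - L v₀ := by
        rw [← hz]; simp [c]
      rw [map_add, this]; abel
    · have h1 : v₀ t = w t := by simp only [v₀]; rw [dif_pos t.2]
      have h2 : (∑ q, z q • (Pi.single (a q) 1 : Fin n → ℝ)) t = 0 := by
        rw [Finset.sum_apply]
        refine Finset.sum_eq_zero fun q _ => ?_
        have : (t : Fin n) ≠ a q := fun h => by
          have := t.2
          rw [h] at this
          simp at this
        simp [this]
      rw [Pi.add_apply, h1, h2, add_zero]

/-- The chart map `g` together with the `T`-coordinates is a submersion at `a`, so the projection of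
`V` to these coordinates contains a box; a polynomial vanishing on a box is zero. -/
theorem exists_independent_coordinates {n k : ℕ} {V : Set (Fin n → ℝ)} {a : Fin n → ℝ}
    (h : IsSubmanifoldAt V a k) :
    ∃ T : Finset (Fin n), T.card = k ∧ ∀ p : MvPolynomial T ℝ,
      MvPolynomial.rename (↑) p ∈ MvPolynomial.vanishingIdeal ℝ V → p = 0 := by
  obtain ⟨haV, m, W, g, hmk, hW, haW, hg, hsurj, hVW⟩ := h
  obtain ⟨T, hT, hTs⟩ := exists_coordinates_surjective hmk (fderiv ℝ g a).toLinearMap hsurj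
  refine ⟨T, hT, fun p hp => ?_⟩
  let P : (Fin n → ℝ) →L[ℝ] (T → ℝ) :=
    ContinuousLinearMap.pi fun t : T => ContinuousLinearMap.proj (t : Fin n)
  have hg' : HasStrictFDerivAt g (fderiv ℝ g a) a :=
    (hg.contDiffAt (hW.mem_nhds haW)).hasStrictFDerivAt (by simp)
  have hΦ := hg'.prodMk P.hasStrictFDerivAt
  have hmap := hΦ.map_nhds_eq_of_surj (by
    rw [LinearMap.range_eq_top]
    rintro ⟨u, w⟩
    obtain ⟨v, hv1, hv2⟩ := hTs u w
    exact ⟨v, Prod.ext hv1 (funext hv2)⟩)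
  have hga : g a = 0 := by
    have : a ∈ V ∩ W := ⟨haV, haW⟩
    rw [hVW] at this
    exact this.2
  have hmem : (fun x => (g x, P x)) '' W ∈ 𝓝 (g a, P a) := by
    rw [← hmap]
    exact image_mem_map (hW.mem_nhds haW)
  rw [nhds_prod_eq, hga] at hmem
  obtain ⟨s, hs, t, ht, hst⟩ := Filter.mem_prod_iff.1 hmem
  obtain ⟨ε, hε, hball⟩ := Metric.mem_nhds_iff.1 ht
  have hzero : ∀ y ∈ Set.pi Set.univ fun i : T => Metric.ball (P a i) ε,
      MvPolynomial.eval y p = MvPolynomial.eval y 0 := by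
    intro y hy
    have hyt : y ∈ t := hball (by
      rw [← ball_pi _ hε] at hy
      exact hy)
    obtain ⟨x, hxW, hx⟩ := hst (Set.mk_mem_prod (mem_of_mem_nhds hs) hyt)
    have hxV : x ∈ V ∩ W := by
      rw [hVW]; exact ⟨hxW, congrArg Prod.fst hx⟩
    have := hp x hxV.1
    rw [MvPolynomial.aeval_rename] at this
    have hxy : x ∘ Subtype.val = y := congrArg Prod.snd hx
    rw [hxy] at this
    rw [map_zero, ← this]; rfl
  refine MvPolynomial.funext_set _ (fun i => ?_) hzero
  rw [Real.ball_eq_Ioo]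
  exact Set.Ioo_infinite (by linarith)

/-! ### Gram determinants and normal parts of gradients -/

open scoped Matrix in
theorem eval_det_gramMatrix {n r : ℕ} (g : Fin r → MvPolynomial (Fin n) ℝ) (x : Fin n → ℝ)
    (N : Matrix (Fin r) (Fin n) ℝ) (hN : N = Matrix.of fun i => grad (g i) x) :
    MvPolynomial.eval x (gramMatrix g).det = (N * Nᵀ).det := by
  rw [RingHom.map_det, gramMatrix, RingHom.mapMatrix_apply, Matrix.map_mul, Matrix.transpose_map,
    hN]
  rfl

-- Over the reals `N * Nᵀ` has the same rank as `N`. This turns independence of gradients into the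
-- nonvanishing of one polynomial.
open scoped Matrix in
theorem eval_det_gramMatrix_ne_zero_iff {n r : ℕ} (g : Fin r → MvPolynomial (Fin n) ℝ)
    (x : Fin n → ℝ) :
    MvPolynomial.eval x (gramMatrix g).det ≠ 0 ↔
      LinearIndependent ℝ (fun i => grad (g i) x) := by
  let N : Matrix (Fin r) (Fin n) ℝ := Matrix.of fun i => grad (g i) x
  rw [eval_det_gramMatrix g x N rfl, ← isUnit_iff_ne_zero, ← Matrix.isUnit_iff_isUnit_det,
    ← Matrix.linearIndependent_rows_iff_isUnit]
  have key : ∀ {p : ℕ} (M : Matrix (Fin r) (Fin p) ℝ),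
      LinearIndependent ℝ M.row ↔ r = M.rank := fun M => by
    rw [linearIndependent_iff_card_eq_finrank_span, Fintype.card_fin,
      Matrix.rank_eq_finrank_span_row]
    rfl
  rw [key, Matrix.rank_self_mul_transpose, ← key]
  rfl

open scoped Matrix in
/-- The component of the gradient of `f` orthogonal to the gradients of the `g i`, multiplied by
the Gram determinant. -/
noncomputable def normalPart {n r : ℕ} (g : Fin r → MvPolynomial (Fin n) ℝ)
    (f : MvPolynomial (Fin n) ℝ) : Fin n → MvPolynomial (Fin n) ℝ :=
  (gramMatrix g).det • (fun t => MvPolynomial.pderiv t f) -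
    (((fun t => MvPolynomial.pderiv t f) ᵥ* (gradMatrix g)ᵀ) ᵥ* (gramMatrix g).adjugate) ᵥ*
      gradMatrix g

open scoped Matrix in
theorem eval_normalPart {n r : ℕ} (g : Fin r → MvPolynomial (Fin n) ℝ)
    (f : MvPolynomial (Fin n) ℝ) (x : Fin n → ℝ) (N : Matrix (Fin r) (Fin n) ℝ)
    (hN : N = Matrix.of fun i => grad (g i) x) :
    (fun t => MvPolynomial.eval x (normalPart g f t)) =
      (N * Nᵀ).det • grad f x - ((grad f x ᵥ* Nᵀ) ᵥ* (N * Nᵀ).adjugate) ᵥ* N := by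
  have h0 : (gradMatrix g).map (MvPolynomial.eval x) = N := by rw [hN]; rfl
  have h1 : (gramMatrix g).map (MvPolynomial.eval x) = N * Nᵀ := by
    rw [gramMatrix, Matrix.map_mul, Matrix.transpose_map, h0]
  have h2 : (gramMatrix g).adjugate.map (MvPolynomial.eval x) = (N * Nᵀ).adjugate := by
    have := RingHom.map_adjugate (MvPolynomial.eval x) (gramMatrix g)
    rw [RingHom.mapMatrix_apply, RingHom.mapMatrix_apply, h1] at this
    exact this
  have hvm : ∀ {p q : ℕ} (M : Matrix (Fin p) (Fin q) (MvPolynomial (Fin n) ℝ)) (v),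
      MvPolynomial.eval x ∘ (v ᵥ* M) =
        (MvPolynomial.eval x ∘ v) ᵥ* M.map (MvPolynomial.eval x) :=
    fun M v => funext fun i => RingHom.map_vecMul _ M v i
  have h4 : (fun t => MvPolynomial.eval x (normalPart g f t)) =
      MvPolynomial.eval x (gramMatrix g).det • grad f x - MvPolynomial.eval x ∘
        ((((fun t => MvPolynomial.pderiv t f) ᵥ* (gradMatrix g)ᵀ) ᵥ* (gramMatrix g).adjugate) ᵥ*
          gradMatrix g) := by
    funext t
    simp [normalPart, grad]
  rw [h4, hvm, hvm, hvm, h2, eval_det_gramMatrix g x N hN, Matrix.transpose_map, h0]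
  rfl

-- Where the gradients of the `g i` are independent, `grad f` equals its projection to their span
-- and the normal part vanishes. The extra determinant factor takes care of the other points.
open scoped Matrix in
theorem det_gramMatrix_mul_normalPart_mem {n r : ℕ} {V : Set (Fin n → ℝ)}
    (g : Fin r → MvPolynomial (Fin n) ℝ) (f : MvPolynomial (Fin n) ℝ)
    (hf : ∀ x ∈ V, LinearIndependent ℝ (fun i => grad (g i) x) →
      grad f x ∈ Submodule.span ℝ (Set.range fun i => grad (g i) x)) (t : Fin n) :
    (gramMatrix g).det * normalPart g f t ∈ MvPolynomial.vanishingIdeal ℝ V := by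
  intro x hx
  change MvPolynomial.eval x _ = 0
  rw [map_mul]
  by_cases h0 : MvPolynomial.eval x (gramMatrix g).det = 0
  · rw [h0, zero_mul]
  obtain ⟨c, hc⟩ := (Submodule.mem_span_range_iff_exists_fun ℝ).1
    (hf x hx ((eval_det_gramMatrix_ne_zero_iff g x).1 h0))
  let N : Matrix (Fin r) (Fin n) ℝ := Matrix.of fun i => grad (g i) x
  have hcN : grad f x = c ᵥ* N := by
    rw [← hc]; ext s; simp [Matrix.vecMul, dotProduct, N]
  have h1 := congrFun (eval_normalPart g f x N rfl) t
  have h2 : (N * Nᵀ).det • grad f x - ((grad f x ᵥ* Nᵀ) ᵥ* (N * Nᵀ).adjugate) ᵥ* N = 0 := by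
    rw [hcN, Matrix.vecMul_vecMul c N Nᵀ, Matrix.vecMul_vecMul c, Matrix.mul_adjugate,
      Matrix.vecMul_smul, Matrix.vecMul_one, Matrix.smul_vecMul, sub_self]
  rw [h2] at h1
  rw [h1]; simp

open scoped Matrix in
theorem normalPart_dotProduct {n r : ℕ} (g : Fin r → MvPolynomial (Fin n) ℝ)
    (f : MvPolynomial (Fin n) ℝ) (x v : Fin n → ℝ) (hv : ∀ i, grad (g i) x ⬝ᵥ v = 0) :
    (fun t => MvPolynomial.eval x (normalPart g f t)) ⬝ᵥ v =
      MvPolynomial.eval x (gramMatrix g).det * (grad f x ⬝ᵥ v) := by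
  let N : Matrix (Fin r) (Fin n) ℝ := Matrix.of fun i => grad (g i) x
  have hNv : N *ᵥ v = 0 := funext hv
  rw [eval_normalPart g f x N rfl, sub_dotProduct, ← Matrix.dotProduct_mulVec, hNv,
    dotProduct_zero, sub_zero, smul_dotProduct, eval_det_gramMatrix g x N rfl, smul_eq_mul]

/-! ### Local equations at points of maximal rank -/

/-- Polynomials whose normal parts lie in the ideal they generate vanish along every curve that
starts at a common zero and is tangent to the level sets of the `g i`. -/
theorem eval_eq_zero_of_curve {n r l : ℕ} (g : Fin r → MvPolynomial (Fin n) ℝ)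
    (h : Fin l → MvPolynomial (Fin n) ℝ)
    (hn : ∀ j t, (gramMatrix g).det * normalPart g (h j) t ∈ Ideal.span (Set.range h))
    (γ γ' : ℝ → (Fin n → ℝ)) (hγ : ∀ s ∈ Set.Icc (0 : ℝ) 1, HasDerivAt γ (γ' s) s)
    (hγ' : ContinuousOn γ' (Set.Icc 0 1))
    (htan : ∀ s ∈ Set.Icc (0 : ℝ) 1, ∀ i, grad (g i) (γ s) ⬝ᵥ γ' s = 0)
    (hΔ : ∀ s ∈ Set.Icc (0 : ℝ) 1, MvPolynomial.eval (γ s) (gramMatrix g).det ≠ 0)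
    (h0 : ∀ j, MvPolynomial.eval (γ 0) (h j) = 0) (j : Fin l) :
    MvPolynomial.eval (γ 1) (h j) = 0 := by
  have hγc : ContinuousOn γ (Set.Icc 0 1) := fun s hs => (hγ s hs).continuousAt.continuousWithinAt
  have hpc : ∀ p : MvPolynomial (Fin n) ℝ,
      ContinuousOn (fun s => MvPolynomial.eval (γ s) p) (Set.Icc 0 1) := fun p =>
    (MvPolynomial.continuous_eval p).comp_continuousOn hγc
  choose c hc using fun j t => Ideal.mem_span_range_iff_exists_fun.1 (hn j t)
  let F : ℝ → (Fin l → ℝ) := fun s j => MvPolynomial.eval (γ s) (h j)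
  let F' : ℝ → (Fin l → ℝ) := fun s j => grad (h j) (γ s) ⬝ᵥ γ' s
  have hF : ∀ s ∈ Set.Icc (0 : ℝ) 1, HasDerivAt F (F' s) s := fun s hs => by
    rw [hasDerivAt_pi]
    intro j
    have := ((hasStrictFDerivAt_eval (h j) (γ s)).hasFDerivAt).comp_hasDerivAt s (hγ s hs)
    rw [differential_apply] at this
    exact this
  -- The coefficient matrix of the linear ODE `F' = b F`. One factor of the Gram determinant comes
  -- from `normalPart_dotProduct`, the other from `hn`, hence the inverse square.
  let b : Fin l → Fin l → ℝ → ℝ := fun j k s =>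
    ((MvPolynomial.eval (γ s) (gramMatrix g).det) ^ 2)⁻¹ *
      ∑ t, MvPolynomial.eval (γ s) (c j t k) * γ' s t
  have hb : ∀ j k, ContinuousOn (b j k) (Set.Icc 0 1) := fun j k => by
    refine ContinuousOn.mul (((hpc _).pow 2).inv₀ fun s hs => pow_ne_zero 2 (hΔ s hs)) ?_
    exact continuousOn_finsetSum _ fun t _ =>
      (hpc _).mul ((continuous_apply t).comp_continuousOn hγ')
  have hF' : ∀ s ∈ Set.Icc (0 : ℝ) 1, ∀ j, F' s j = ∑ k, b j k s * F s k := fun s hs j => by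
    have h1 := normalPart_dotProduct g (h j) (γ s) (γ' s) (htan s hs)
    have h2 : ∀ t, MvPolynomial.eval (γ s) (gramMatrix g).det *
        MvPolynomial.eval (γ s) (normalPart g (h j) t) =
        ∑ k, MvPolynomial.eval (γ s) (c j t k) * F s k := fun t => by
      rw [← map_mul, ← hc j t]; simp [F]
    have h3 : MvPolynomial.eval (γ s) (gramMatrix g).det ^ 2 * F' s j =
        ∑ k, (∑ t, MvPolynomial.eval (γ s) (c j t k) * γ' s t) * F s k := by
      rw [pow_two, mul_assoc, ← h1, dotProduct, Finset.mul_sum]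
      simp_rw [← mul_assoc, h2, Finset.sum_mul]
      rw [Finset.sum_comm]
      exact Finset.sum_congr rfl fun _ _ => Finset.sum_congr rfl fun _ _ => by ring
    have hne := pow_ne_zero 2 (hΔ s hs)
    simp only [b, mul_assoc, ← Finset.mul_sum]
    rw [← h3, inv_mul_cancel_left₀ hne]
  obtain ⟨K, hK⟩ := isCompact_Icc.exists_bound_of_continuousOn (s := Set.Icc (0 : ℝ) 1)
    (f := fun s => ∑ j, ∑ k, |b j k s|)
    (continuousOn_finsetSum _ fun j _ => continuousOn_finsetSum _ fun k _ => (hb j k).abs)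
  have hbound : ∀ s ∈ Set.Icc (0 : ℝ) 1, ‖F' s‖ ≤ K * ‖F s‖ := fun s hs => by
    have hS := (le_abs_self _).trans (hK s hs)
    have hnn : 0 ≤ ∑ j, ∑ k, |b j k s| :=
      Finset.sum_nonneg fun _ _ => Finset.sum_nonneg fun _ _ => abs_nonneg _
    rw [pi_norm_le_iff_of_nonneg (mul_nonneg (hnn.trans hS) (norm_nonneg _))]
    intro j
    rw [hF' s hs j]
    calc ‖∑ k, b j k s * F s k‖ ≤ ∑ k, |b j k s| * ‖F s‖ := by
          refine norm_sum_le_of_le _ fun k _ => ?_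
          rw [norm_mul, Real.norm_eq_abs]
          exact mul_le_mul_of_nonneg_left (norm_le_pi_norm _ _) (abs_nonneg _)
      _ = (∑ k, |b j k s|) * ‖F s‖ := by rw [Finset.sum_mul]
      _ ≤ K * ‖F s‖ := by
          refine mul_le_mul_of_nonneg_right (le_trans ?_ hS) (norm_nonneg _)
          exact Finset.single_le_sum (f := fun j => ∑ k, |b j k s|)
            (fun _ _ => Finset.sum_nonneg fun _ _ => abs_nonneg _) (Finset.mem_univ j)
  -- Grönwall: `‖F'‖ ≤ K ‖F‖` and `F 0 = 0` force `F = 0`.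
  have := eq_zero_of_abs_deriv_le_mul_abs_self_of_eq_zero_right (f := F) (f' := F') (K := K)
    (a := 0) (b := 1) (fun s hs => (hF s hs).continuousAt.continuousWithinAt)
    (fun s hs => (hF s ⟨hs.1, hs.2.le⟩).hasDerivWithinAt) (funext h0)
    (fun s hs => hbound s ⟨hs.1, hs.2.le⟩) 1 (by simp)
  exact congrFun this j

theorem surjective_pi_differential {n r : ℕ} (g : Fin r → MvPolynomial (Fin n) ℝ)
    (a : Fin n → ℝ) (hli : LinearIndependent ℝ (fun i => grad (g i) a)) :
    Function.Surjective (ContinuousLinearMap.pi fun i => differential (g i) a) := by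
  let N : Matrix (Fin r) (Fin n) ℝ := Matrix.of fun i => grad (g i) a
  have hr : N.rank = r := by
    simpa using LinearIndependent.rank_matrix (M := N) hli
  have h2 : LinearMap.range N.mulVecLin = ⊤ := by
    apply Submodule.eq_top_of_finrank_eq
    rw [Module.finrank_fintype_fun_eq_card, Fintype.card_fin]
    exact hr
  intro u
  obtain ⟨v, hv⟩ := LinearMap.range_eq_top.1 h2 u
  refine ⟨v, ?_⟩
  rw [← hv]
  funext i
  exact differential_apply (g i) a v

/-- Near a point with independent gradients, each point of the common zero set of the `g i` is
joined to the base point by a `C¹` curve inside this set and inside any given neighbourhood. -/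
theorem exists_curve {n r : ℕ} (g : Fin r → MvPolynomial (Fin n) ℝ) (a : Fin n → ℝ)
    (ha : ∀ i, MvPolynomial.eval a (g i) = 0)
    (hli : LinearIndependent ℝ (fun i => grad (g i) a)) {O : Set (Fin n → ℝ)} (hO : O ∈ 𝓝 a) :
    ∃ W : Set (Fin n → ℝ), IsOpen W ∧ a ∈ W ∧ ∀ x ∈ W, (∀ i, MvPolynomial.eval x (g i) = 0) →
      ∃ γ γ' : ℝ → (Fin n → ℝ), γ 0 = a ∧ γ 1 = x ∧
        (∀ s ∈ Set.Icc (0 : ℝ) 1, HasDerivAt γ (γ' s) s) ∧ ContinuousOn γ' (Set.Icc 0 1) ∧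
        (∀ s ∈ Set.Icc (0 : ℝ) 1, ∀ i, grad (g i) (γ s) ⬝ᵥ γ' s = 0) ∧
        ∀ s ∈ Set.Icc (0 : ℝ) 1, γ s ∈ O := by
  let G : (Fin n → ℝ) → (Fin r → ℝ) := fun x i => MvPolynomial.eval x (g i)
  let L : (Fin n → ℝ) →L[ℝ] (Fin r → ℝ) := ContinuousLinearMap.pi fun i => differential (g i) a
  have hG : HasStrictFDerivAt G L a :=
    hasStrictFDerivAt_pi.2 fun i => hasStrictFDerivAt_eval (g i) a
  have hGc : ContDiff ℝ 1 G := contDiff_pi.2 fun i => contDiff_eval (g i)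
  have hL : Function.Surjective L := surjective_pi_differential g a hli
  have hrn : r ≤ n := by
    have := LinearMap.finrank_le_finrank_of_surjective (f := L.toLinearMap) hL
    simpa using this
  obtain ⟨T, hT, hTs⟩ := exists_coordinates_surjective (Nat.add_sub_cancel' hrn) L.toLinearMap hL
  let P : (Fin n → ℝ) →L[ℝ] (T → ℝ) :=
    ContinuousLinearMap.pi fun t : T => ContinuousLinearMap.proj (t : Fin n)
  have hsurj : Function.Surjective (L.prod P) := by
    rintro ⟨u, w⟩
    obtain ⟨v, hv1, hv2⟩ := hTs u w
    exact ⟨v, Prod.ext hv1 (funext hv2)⟩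
  have hinj : Function.Injective (L.prod P) :=
    (LinearMap.injective_iff_surjective_of_finrank_eq_finrank
      (f := (L.prod P).toLinearMap) (by simp [hT, hrn])).2 hsurj
  let E : (Fin n → ℝ) ≃L[ℝ] (Fin r → ℝ) × (T → ℝ) :=
    ContinuousLinearEquiv.ofBijective (L.prod P) (LinearMap.ker_eq_bot.2 hinj)
      (LinearMap.range_eq_top.2 hsurj)
  let Φ : (Fin n → ℝ) → (Fin r → ℝ) × (T → ℝ) := fun x => (G x, P x)
  have hΦc : ContDiff ℝ 1 Φ := hGc.prodMk P.contDiff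
  have hΦ : HasStrictFDerivAt Φ (E : (Fin n → ℝ) →L[ℝ] (Fin r → ℝ) × (T → ℝ)) a :=
    hG.prodMk P.hasStrictFDerivAt
  let Ψ := hΦ.localInverse Φ E a
  have hΨc : ContDiffAt ℝ 1 Ψ (Φ a) := hΦc.contDiffAt.to_localInverse hΦ.hasFDerivAt one_ne_zero
  have hΨa : Ψ (Φ a) = a := hΦ.localInverse_apply_image
  have e1 : ∀ᶠ y in 𝓝 (Φ a), ContDiffAt ℝ 1 Ψ y := hΨc.eventually (by simp)
  have e2 : ∀ᶠ y in 𝓝 (Φ a), Φ (Ψ y) = y := hΦ.eventually_right_inverse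
  have e3 : ∀ᶠ y in 𝓝 (Φ a), Ψ y ∈ O := hΨc.continuousAt (by rw [hΨa]; exact hO)
  obtain ⟨ε, hε, hB⟩ := Metric.eventually_nhds_iff_ball.1 (e1.and (e2.and e3))
  have e4 : ∀ᶠ x in 𝓝 a, Ψ (Φ x) = x ∧ Φ x ∈ Metric.ball (Φ a) ε :=
    hΦ.eventually_left_inverse.and
      (hΦc.continuous.continuousAt (Metric.ball_mem_nhds _ hε))
  obtain ⟨W, hWs, hWo, haW⟩ := mem_nhds_iff.1 e4
  refine ⟨W, hWo, haW, fun x hxW hx => ?_⟩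
  obtain ⟨hx1, hx2⟩ := hWs hxW
  -- The curve is the preimage under the local diffeomorphism `Φ = (G, P)` of the segment from `Φ a`
  -- to `Φ x`. The segment stays in the convex ball, and its first component is constantly `0`.
  let y : ℝ → (Fin r → ℝ) × (T → ℝ) := fun s => Φ a + s • (Φ x - Φ a)
  have hyc : ContDiff ℝ 1 y := contDiff_const.add (contDiff_id.smul contDiff_const)
  let J : Set ℝ := y ⁻¹' Metric.ball (Φ a) ε
  have hJ : IsOpen J := Metric.isOpen_ball.preimage hyc.continuous
  have hIJ : Set.Icc (0 : ℝ) 1 ⊆ J := fun s hs =>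
    (convex_ball (Φ a) ε).add_smul_sub_mem (Metric.mem_ball_self hε) hx2 hs
  have hγJ : ContDiffOn ℝ 1 (fun s => Ψ (y s)) J := fun s hs =>
    ((hB (y s) hs).1.comp s hyc.contDiffAt).contDiffWithinAt
  have hγd : ∀ s ∈ J, HasDerivAt (fun s => Ψ (y s)) (deriv (fun s => Ψ (y s)) s) s := fun s hs =>
    ((hγJ.differentiableOn one_ne_zero).differentiableAt (hJ.mem_nhds hs)).hasDerivAt
  have hGa : G a = 0 := funext ha
  have hGx : G x = 0 := funext hx
  have hGy : ∀ s ∈ J, G (Ψ (y s)) = 0 := fun s hs => by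
    have := congrArg Prod.fst (hB (y s) hs).2.1
    change G (Ψ (y s)) = _ at this
    rw [this]
    simp [y, Φ, hGa, hGx]
  refine ⟨fun s => Ψ (y s), deriv (fun s => Ψ (y s)), ?_, ?_, fun s hs => hγd s (hIJ hs),
    (hγJ.continuousOn_deriv_of_isOpen hJ le_rfl).mono hIJ, fun s hs i => ?_,
    fun s hs => (hB (y s) (hIJ hs)).2.2⟩
  · simp [y, hΨa]
  · simp [y, hx1]
  · have h1 := ((hasStrictFDerivAt_eval (g i) (Ψ (y s))).hasFDerivAt).comp_hasDerivAt s
      (hγd s (hIJ hs))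
    rw [differential_apply] at h1
    refine h1.unique ((hasDerivAt_const s (0 : ℝ)).congr_of_eventuallyEq ?_)
    filter_upwards [hJ.mem_nhds (hIJ hs)] with u hu
    exact congrFun (hGy u hu) i

/-- At a point of maximal rank a variety is locally cut out by any elements of its ideal whose
gradients form a basis of the normal space. -/
theorem exists_isOpen_mem_of_eval_eq_zero {n r l : ℕ} {V : Set (Fin n → ℝ)}
    {h : Fin l → MvPolynomial (Fin n) ℝ} (hgen : Generates h V) (hV : zeroSet h = V)
    {a : Fin n → ℝ} (haV : a ∈ V) (g : Fin r → MvPolynomial (Fin n) ℝ)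
    (hgV : ∀ i, g i ∈ MvPolynomial.vanishingIdeal ℝ V)
    (hli : LinearIndependent ℝ (fun i => grad (g i) a))
    (hmax : ∀ x ∈ V, LinearIndependent ℝ (fun i => grad (g i) x) →
      ∀ j, grad (h j) x ∈ Submodule.span ℝ (Set.range fun i => grad (g i) x)) :
    ∃ W : Set (Fin n → ℝ), IsOpen W ∧ a ∈ W ∧
      ∀ x ∈ W, (∀ i, MvPolynomial.eval x (g i) = 0) → x ∈ V := by
  have hO : {x | MvPolynomial.eval x (gramMatrix g).det ≠ 0} ∈ 𝓝 a :=
    (isOpen_ne_fun (MvPolynomial.continuous_eval _) continuous_const).mem_nhds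
      ((eval_det_gramMatrix_ne_zero_iff g a).2 hli)
  obtain ⟨W, hWo, haW, hW⟩ := exists_curve g a (fun i => hgV i a haV) hli hO
  refine ⟨W, hWo, haW, fun x hx hgx => ?_⟩
  obtain ⟨γ, γ', h0, h1, hd, hc, ht, hin⟩ := hW x hx hgx
  rw [← hV]
  intro j
  rw [← h1]
  refine eval_eq_zero_of_curve g h (fun j t => ?_) γ γ' hd hc ht hin (fun j => ?_) j
  · rw [hgen]
    exact det_gramMatrix_mul_normalPart_mem g (h j) (fun x hx hl => hmax x hx hl j) t
  · rw [← hV] at haV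
    rw [h0]; exact haV j

/-! ### Varieties and vanishing ideals -/

theorem exists_generates {n : ℕ} (V : Set (Fin n → ℝ)) :
    ∃ (l : ℕ) (h : Fin l → MvPolynomial (Fin n) ℝ), Generates h V := by
  obtain ⟨l, h, hh⟩ := Submodule.fg_iff_exists_fin_generating_family.1
    (IsNoetherian.noetherian (MvPolynomial.vanishingIdeal ℝ V))
  exact ⟨l, h, hh⟩

theorem isVariety_setOf {n : ℕ} (S : Set (MvPolynomial (Fin n) ℝ)) :
    IsVariety {x | ∀ f ∈ S, MvPolynomial.eval x f = 0} := by
  obtain ⟨l, h, hh⟩ := Submodule.fg_iff_exists_fin_generating_family.1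
    (IsNoetherian.noetherian (Ideal.span S))
  refine ⟨l, h, Set.ext fun x => ⟨fun hx j => ?_, fun hx f hf => ?_⟩⟩
  · have h1 : Ideal.span S ≤ RingHom.ker (MvPolynomial.eval x) := Ideal.span_le.2 hx
    refine h1 ?_
    rw [← hh]
    exact Submodule.subset_span (Set.mem_range_self j)
  · have h1 : Ideal.span (Set.range h) ≤ RingHom.ker (MvPolynomial.eval x) :=
      Ideal.span_le.2 (by rintro _ ⟨j, rfl⟩; exact hx j)
    refine h1 ?_
    change f ∈ Submodule.span _ (Set.range h)
    rw [hh]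
    exact Ideal.subset_span hf

theorem IsVariety.inter_setOf {n : ℕ} {V : Set (Fin n → ℝ)} (hV : IsVariety V)
    (S : Set (MvPolynomial (Fin n) ℝ)) :
    IsVariety {x ∈ V | ∀ f ∈ S, MvPolynomial.eval x f = 0} := by
  obtain ⟨l, h, rfl⟩ := hV
  convert isVariety_setOf (Set.range h ∪ S) using 1
  ext x
  simp [zeroSet, or_imp, forall_and]

theorem IsVariety.zeroSet_eq {n l : ℕ} {V : Set (Fin n → ℝ)} (hV : IsVariety V)
    {q : Fin l → MvPolynomial (Fin n) ℝ} (hq : Generates q V) : zeroSet q = V := by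
  obtain ⟨m, h, rfl⟩ := hV
  ext x
  refine ⟨fun hx j => ?_, fun hx j => ?_⟩
  · have h1 : Ideal.span (Set.range q) ≤ RingHom.ker (MvPolynomial.eval x) :=
      Ideal.span_le.2 (by rintro _ ⟨j, rfl⟩; exact hx j)
    refine h1 ?_
    rw [hq]
    exact fun y hy => hy j
  · have : q j ∈ MvPolynomial.vanishingIdeal ℝ (zeroSet h) := by
      rw [← hq]; exact Ideal.subset_span (Set.mem_range_self j)
    exact this x hx

/-- Nonemptiness is needed because `∅` counts as irreducible while its vanishing ideal is the whole
ring. -/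
theorem IsIrred.isPrime {n : ℕ} {V : Set (Fin n → ℝ)} (hV : IsIrred V) (hne : V.Nonempty) :
    (MvPolynomial.vanishingIdeal ℝ V).IsPrime := by
  refine ⟨?_, fun {f g} hfg => ?_⟩
  · rw [Ideal.ne_top_iff_one]
    intro h1
    obtain ⟨x, hx⟩ := hne
    simpa using h1 x hx
  · have hu : V = {x ∈ V | ∀ p ∈ ({f} : Set _), MvPolynomial.eval x p = 0} ∪
        {x ∈ V | ∀ p ∈ ({g} : Set _), MvPolynomial.eval x p = 0} := by
      ext x
      refine ⟨fun hx => ?_, by rintro (hx | hx) <;> exact hx.1⟩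
      have h1 : MvPolynomial.eval x (f * g) = 0 := hfg x hx
      rw [map_mul, mul_eq_zero] at h1
      rcases h1 with h1 | h1
      · exact Or.inl ⟨hx, by simpa using h1⟩
      · exact Or.inr ⟨hx, by simpa using h1⟩
    rcases hV.2 _ _ (hV.1.inter_setOf {f}) (hV.1.inter_setOf {g}) hu with h1 | h1
    · exact Or.inl fun x hx => by rw [← h1] at hx; exact hx.2 f rfl
    · exact Or.inr fun x hx => by rw [← h1] at hx; exact hx.2 g rfl

/-! ### Normal spaces, dimension and the singular locus -/

/-- The space spanned by the gradients at `a` of the polynomials vanishing on `V`. -/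
noncomputable def normalSpace {n : ℕ} (V : Set (Fin n → ℝ)) (a : Fin n → ℝ) :
    Submodule ℝ (Fin n → ℝ) :=
  Submodule.span ℝ ((fun f => grad f a) '' (MvPolynomial.vanishingIdeal ℝ V : Set _))

theorem grad_mem_normalSpace {n : ℕ} {V : Set (Fin n → ℝ)} {f : MvPolynomial (Fin n) ℝ}
    (hf : f ∈ MvPolynomial.vanishingIdeal ℝ V) (a : Fin n → ℝ) : grad f a ∈ normalSpace V a :=
  Submodule.subset_span ⟨f, hf, rfl⟩

theorem Generates.mem {n l : ℕ} {V : Set (Fin n → ℝ)} {h : Fin l → MvPolynomial (Fin n) ℝ}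
    (hh : Generates h V) (j : Fin l) : h j ∈ MvPolynomial.vanishingIdeal ℝ V := by
  rw [← hh]; exact Ideal.subset_span (Set.mem_range_self j)

/-- In the product rule for `∑ c_j h_j` the terms with the derivative of `c_j` drop out, as every
`h_j` vanishes at `a`. So Jacobian ranks do not depend on the generators. -/
theorem Generates.span_grad {n l : ℕ} {V : Set (Fin n → ℝ)}
    {h : Fin l → MvPolynomial (Fin n) ℝ} (hh : Generates h V) {a : Fin n → ℝ} (ha : a ∈ V) :
    Submodule.span ℝ (Set.range fun j => grad (h j) a) = normalSpace V a := by
  apply le_antisymm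
  · rw [Submodule.span_le]
    rintro _ ⟨j, rfl⟩
    exact grad_mem_normalSpace (hh.mem j) a
  · rw [normalSpace, Submodule.span_le]
    rintro _ ⟨f, hf, rfl⟩
    have hf' : f ∈ Ideal.span (Set.range h) := by rw [hh]; exact hf
    obtain ⟨c, rfl⟩ := Ideal.mem_span_range_iff_exists_fun.1 hf'
    have : grad (∑ j, c j * h j) a = ∑ j, MvPolynomial.eval a (c j) • grad (h j) a := by
      ext t
      have hz : ∀ j, MvPolynomial.eval a (h j) = 0 := fun j => hh.mem j a ha
      simp [grad, hz]
    change grad _ a ∈ _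
    rw [this]
    exact Submodule.sum_mem _ fun j _ =>
      Submodule.smul_mem _ _ (Submodule.subset_span (Set.mem_range_self j))

theorem Generates.rank_jacobian {n l : ℕ} {V : Set (Fin n → ℝ)}
    {h : Fin l → MvPolynomial (Fin n) ℝ} (hh : Generates h V) {a : Fin n → ℝ} (ha : a ∈ V) :
    (jacobian h a).rank = Module.finrank ℝ (normalSpace V a) := by
  rw [Matrix.rank_eq_finrank_span_cols, ← hh.span_grad ha]
  rfl

theorem Generates.exists_linearIndependent {n l : ℕ} {V : Set (Fin n → ℝ)}
    {h : Fin l → MvPolynomial (Fin n) ℝ} (hh : Generates h V) {a : Fin n → ℝ} (ha : a ∈ V)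
    {r : ℕ} (hr : Module.finrank ℝ (normalSpace V a) = r) :
    ∃ σ : Fin r → Fin l, LinearIndependent ℝ (fun i => grad (h (σ i)) a) := by
  obtain ⟨κ, b, hb, hbspan, hbli⟩ := exists_linearIndependent' ℝ (fun j => grad (h j) a)
  have : Fintype κ := Fintype.ofInjective b hb
  have hκ : Fintype.card κ = r := by
    have := finrank_span_eq_card hbli
    rw [hbspan, hh.span_grad ha, hr] at this
    exact this.symm
  let e : Fin r ≃ κ := (Fintype.equivFinOfCardEq hκ).symm
  exact ⟨b ∘ e, hbli.comp e e.injective⟩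

/-- The points `a` and `b` need not be related: a Gram determinant nonzero at the single point `a`
is outside `I(V)`, so the rank at `a` is at most the generic rank, which the chart at `b` bounds. -/
theorem finrank_normalSpace_add_le {n k : ℕ} {V : Set (Fin n → ℝ)} (hV : IsIrred V)
    {a b : Fin n → ℝ} (ha : a ∈ V) (hb : IsSubmanifoldAt V b k) :
    Module.finrank ℝ (normalSpace V a) + k ≤ n := by
  have := hV.isPrime ⟨a, ha⟩
  obtain ⟨T, hT, hTi⟩ := exists_independent_coordinates hb
  obtain ⟨l, h, hh⟩ := exists_generates V
  obtain ⟨σ, hσ⟩ := hh.exists_linearIndependent ha rfl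
  have := card_add_le_of_gram_notMem _ T hTi (fun i => h (σ i)) (fun i => hh.mem _) fun hmem =>
    (eval_det_gramMatrix_ne_zero_iff _ a).2 hσ (hmem a ha)
  omega

/-- At a point where the normal space has maximal dimension, a variety is locally the zero set of
polynomials in its ideal with independent gradients. -/
theorem IsVariety.exists_local_equations {n r : ℕ} {V : Set (Fin n → ℝ)} (hV : IsVariety V)
    {a : Fin n → ℝ} (ha : a ∈ V) (hr : Module.finrank ℝ (normalSpace V a) = r)
    (hmax : ∀ x ∈ V, Module.finrank ℝ (normalSpace V x) ≤ r) :
    ∃ (g : Fin r → MvPolynomial (Fin n) ℝ) (W : Set (Fin n → ℝ)),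
      (∀ i, g i ∈ MvPolynomial.vanishingIdeal ℝ V) ∧
      LinearIndependent ℝ (fun i => grad (g i) a) ∧ IsOpen W ∧ a ∈ W ∧
      ∀ x ∈ W, (∀ i, MvPolynomial.eval x (g i) = 0) → x ∈ V := by
  obtain ⟨l, h, hh⟩ := exists_generates V
  obtain ⟨σ, hσ⟩ := hh.exists_linearIndependent ha hr
  obtain ⟨W, hW⟩ := exists_isOpen_mem_of_eval_eq_zero hh (hV.zeroSet_eq hh) ha
    (fun i => h (σ i)) (fun i => hh.mem _) hσ (fun x hx hl j => by
      have hle : Submodule.span ℝ (Set.range fun i => grad (h (σ i)) x) ≤ normalSpace V x := by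
        rw [Submodule.span_le]
        rintro _ ⟨i, rfl⟩
        exact grad_mem_normalSpace (hh.mem _) x
      have heq := Submodule.eq_of_le_of_finrank_le hle (by
        rw [finrank_span_eq_card hl, Fintype.card_fin]; exact hmax x hx)
      rw [heq]
      exact grad_mem_normalSpace (hh.mem j) x)
  exact ⟨fun i => h (σ i), W, fun i => hh.mem _, hσ, hW⟩

theorem IsVariety.isSubmanifoldAt {n r k : ℕ} (hrk : r + k = n) {V : Set (Fin n → ℝ)}
    (hV : IsVariety V) {a : Fin n → ℝ} (ha : a ∈ V)
    (hr : Module.finrank ℝ (normalSpace V a) = r)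
    (hmax : ∀ x ∈ V, Module.finrank ℝ (normalSpace V x) ≤ r) : IsSubmanifoldAt V a k := by
  obtain ⟨g, W, hg, hli, hW, haW, hgW⟩ := hV.exists_local_equations ha hr hmax
  refine ⟨ha, r, W, fun x i => MvPolynomial.eval x (g i), hrk, hW, haW,
    (contDiff_pi.2 fun i => contDiff_eval (g i)).contDiffOn, ?_, ?_⟩
  · have hd := hasStrictFDerivAt_pi.2 fun i => hasStrictFDerivAt_eval (g i) a
    rw [hd.hasFDerivAt.fderiv]
    exact surjective_pi_differential g a hli
  · ext x
    exact ⟨fun hx => ⟨hx.2, funext fun i => hg i x hx.1⟩,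
      fun hx => ⟨hgW x hx.1 (congrFun hx.2), hx.1⟩⟩

theorem bddAbove_submanifold_dims {n : ℕ} (V : Set (Fin n → ℝ)) :
    BddAbove {k | ∃ a, IsSubmanifoldAt V a k} :=
  ⟨n, by rintro k ⟨a, -, m, -, -, hmk, -⟩; omega⟩

/-- At a point where the normal space is largest, `V` is a submanifold of complementary dimension,
which bounds `dim V` below. The inequality for all points comes from a chart realizing `dim V`. -/
theorem IsIrred.exists_finrank_add_dim_eq {n : ℕ} {V : Set (Fin n → ℝ)} (hV : IsIrred V)
    (hne : V.Nonempty) :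
    (∀ a ∈ V, Module.finrank ℝ (normalSpace V a) + dim V ≤ n) ∧
      ∃ a ∈ V, Module.finrank ℝ (normalSpace V a) + dim V = n := by
  have hbdd : BddAbove ((fun a => Module.finrank ℝ (normalSpace V a)) '' V) :=
    ⟨n, by
      rintro _ ⟨a, -, rfl⟩
      simpa using Submodule.finrank_le (normalSpace V a)⟩
  obtain ⟨a, ha, hmax⟩ := Nat.sSup_mem (hne.image _) hbdd
  have hle : Module.finrank ℝ (normalSpace V a) ≤ n := by
    simpa using Submodule.finrank_le (normalSpace V a)
  have hsub := hV.1.isSubmanifoldAt (Nat.add_sub_cancel' hle) ha rfl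
    (fun x hx => (le_csSup hbdd ⟨x, hx, rfl⟩).trans hmax.ge)
  obtain ⟨b, hb⟩ := Nat.sSup_mem
    (s := {k | ∃ a, IsSubmanifoldAt V a k}) ⟨_, a, hsub⟩ (bddAbove_submanifold_dims V)
  have h1 : ∀ a ∈ V, Module.finrank ℝ (normalSpace V a) + dim V ≤ n := fun a ha =>
    finrank_normalSpace_add_le hV ha hb
  have h2 : n - Module.finrank ℝ (normalSpace V a) ≤ dim V :=
    le_csSup (bddAbove_submanifold_dims V) ⟨a, hsub⟩
  exact ⟨h1, a, ha, by have := h1 a ha; omega⟩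

theorem mem_regularLocus_iff {n : ℕ} {V : Set (Fin n → ℝ)} {a : Fin n → ℝ} :
    a ∈ regularLocus V ↔ a ∈ V ∧ Module.finrank ℝ (normalSpace V a) + dim V = n := by
  constructor
  · rintro ⟨ha, l, h, hh, hr⟩
    exact ⟨ha, by rw [← hh.rank_jacobian ha]; exact hr⟩
  · rintro ⟨ha, hr⟩
    obtain ⟨l, h, hh⟩ := exists_generates V
    exact ⟨ha, l, h, hh, by rw [hh.rank_jacobian ha]; exact hr⟩

theorem IsIrred.singularLocus_ne {n : ℕ} {V : Set (Fin n → ℝ)} (hV : IsIrred V)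
    (hne : V.Nonempty) : singularLocus V ≠ V := by
  obtain ⟨a, ha, hr⟩ := (hV.exists_finrank_add_dim_eq hne).2
  intro h
  have : a ∈ singularLocus V := by rw [h]; exact ha
  exact this.2 (mem_regularLocus_iff.2 ⟨ha, hr⟩)

/-- The rank never exceeds `n - dim V`, so a point is singular exactly when no `n - dim V` of the
generators have independent gradients there, that is, when all these Gram determinants vanish. -/
theorem IsIrred.isVariety_singularLocus {n : ℕ} {V : Set (Fin n → ℝ)} (hV : IsIrred V)
    (hne : V.Nonempty) : IsVariety (singularLocus V) := by
  have hle := (hV.exists_finrank_add_dim_eq hne).1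
  obtain ⟨l, h, hh⟩ := exists_generates V
  convert hV.1.inter_setOf
    (Set.range fun σ : Fin (n - dim V) → Fin l => (gramMatrix fun i => h (σ i)).det) using 1
  ext x
  simp only [singularLocus, Set.mem_sdiff, mem_regularLocus_iff, Set.mem_ofPred_eq,
    Set.forall_mem_range]
  refine and_congr_right fun hx => ?_
  simp only [hx, true_and]
  constructor
  · intro hn σ
    by_contra hσ
    have hli := (eval_det_gramMatrix_ne_zero_iff _ x).1 hσ
    have hspan : Submodule.span ℝ (Set.range fun i => grad (h (σ i)) x) ≤ normalSpace V x := by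
      rw [Submodule.span_le]
      rintro _ ⟨i, rfl⟩
      exact grad_mem_normalSpace (hh.mem _) x
    have := Submodule.finrank_mono hspan
    rw [finrank_span_eq_card hli, Fintype.card_fin] at this
    have := hle x hx
    omega
  · intro hσ hn
    obtain ⟨σ, hli⟩ := hh.exists_linearIndependent hx
      (r := n - dim V) (by omega)
    exact (eval_det_gramMatrix_ne_zero_iff _ x).2 hli (hσ σ)

/-! ### Lagrange multipliers at regular points -/

/-- First order optimality at a regular point of an irreducible variety. -/
theorem IsIrred.kkt {n r : ℕ} {V : Set (Fin n → ℝ)} (hV : IsIrred V)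
    {f : MvPolynomial (Fin n) ℝ} {x : Fin n → ℝ} (hx : x ∈ regularLocus V)
    (hmin : ∀ y ∈ V, MvPolynomial.eval x f ≤ MvPolynomial.eval y f)
    {q : Fin r → MvPolynomial (Fin n) ℝ} (hq : Generates q V) : KKT f q x := by
  obtain ⟨hxV, hr⟩ := mem_regularLocus_iff.1 hx
  have hle := (hV.exists_finrank_add_dim_eq ⟨x, hxV⟩).1
  obtain ⟨g, W, hg, hli, hW, hxW, hgW⟩ := hV.1.exists_local_equations hxV rfl
    (fun y hy => by have := hle y hy; omega)
  have hext : IsLocalExtrOn (fun y => MvPolynomial.eval y f)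
      {y | ∀ i, MvPolynomial.eval y (g i) = MvPolynomial.eval x (g i)} x := by
    refine Or.inl ?_
    change ∀ᶠ y in 𝓝[_] x, _
    filter_upwards [self_mem_nhdsWithin, mem_nhdsWithin_of_mem_nhds (hW.mem_nhds hxW)]
      with y hy hyW
    exact hmin y (hgW y hyW fun i => (hy i).trans (hg i x hxV))
  obtain ⟨Λ, Λ₀, hne, hsum⟩ := hext.exists_multipliers_of_hasStrictFDerivAt
    (fun i => hasStrictFDerivAt_eval (g i) x) (hasStrictFDerivAt_eval f x)
  have hvec : ∑ i, Λ i • grad (g i) x + Λ₀ • grad f x = 0 := by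
    ext t
    have := DFunLike.congr_fun hsum (Pi.single t 1)
    simpa [differential_apply] using this
  -- Independence of the constraint gradients rules out a vanishing multiplier of the objective.
  have hΛ₀ : Λ₀ ≠ 0 := by
    rintro rfl
    rw [zero_smul, add_zero] at hvec
    exact hne (Prod.ext (funext (Fintype.linearIndependent_iff.1 hli Λ hvec)) rfl)
  have hmem : grad f x ∈ normalSpace V x := by
    have : grad f x = -Λ₀⁻¹ • ∑ i, Λ i • grad (g i) x := by
      rw [eq_neg_of_add_eq_zero_left hvec, smul_neg, neg_smul, neg_neg, inv_smul_smul₀ hΛ₀]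
    rw [this]
    exact Submodule.smul_mem _ _ (Submodule.sum_mem _ fun i _ =>
      Submodule.smul_mem _ _ (grad_mem_normalSpace (hg i) x))
  rw [← hq.span_grad hxV] at hmem
  obtain ⟨lam, hlam⟩ := (Submodule.mem_span_range_iff_exists_fun ℝ).1 hmem
  refine ⟨lam, fun j => hq.mem j x hxV, fun t => ?_⟩
  have := congrFun hlam t
  simpa [grad] using this.symm

/-! ### Noetherian induction and irreducible components -/

/-- Noetherian induction on varieties. -/
theorem IsVariety.induction {n : ℕ} {P : Set (Fin n → ℝ) → Prop}
    (step : ∀ V, IsVariety V → (∀ V', IsVariety V' → V' ⊂ V → P V') → P V)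
    {V : Set (Fin n → ℝ)} (hV : IsVariety V) : P V := by
  have hwf : WellFounded fun V' V : Set (Fin n → ℝ) =>
      MvPolynomial.vanishingIdeal ℝ V' > MvPolynomial.vanishingIdeal ℝ V :=
    InvImage.wf (fun V : Set (Fin n → ℝ) => MvPolynomial.vanishingIdeal ℝ V)
      (wellFounded_gt (α := Ideal (MvPolynomial (Fin n) ℝ)))
  induction V using hwf.induction with
  | _ V ih =>
    refine step V hV fun V' hV' hlt => ih V' (lt_of_le_of_ne ?_ fun heq => ?_) hV'
    · exact MvPolynomial.vanishingIdeal_anti_mono hlt.1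
    -- A variety is recovered from its vanishing ideal, so proper inclusion makes the ideal strictly
    -- larger.
    · obtain ⟨l, h, hh⟩ := exists_generates V
      have hh' : Generates h V' := Eq.trans hh heq
      exact hlt.ne ((hV'.zeroSet_eq hh').symm.trans (hV.zeroSet_eq hh))

theorem IsVariety.exists_irred_cover {n : ℕ} {V : Set (Fin n → ℝ)} (hV : IsVariety V) :
    ∃ C : List (Set (Fin n → ℝ)), C ≠ [] ∧ (∀ W ∈ C, IsIrred W) ∧ V = {x | ∃ W ∈ C, x ∈ W} := by
  refine IsVariety.induction (P := fun V => ∃ C : List (Set (Fin n → ℝ)), C ≠ [] ∧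
    (∀ W ∈ C, IsIrred W) ∧ V = {x | ∃ W ∈ C, x ∈ W}) (fun V hV ih => ?_) hV
  by_cases hirr : IsIrred V
  · exact ⟨[V], by simp, by simpa using hirr, by simp⟩
  · have : ∃ V₁ V₂, IsVariety V₁ ∧ IsVariety V₂ ∧ V = V₁ ∪ V₂ ∧ V₁ ≠ V ∧ V₂ ≠ V := by
      by_contra hcon
      refine hirr ⟨hV, fun V₁ V₂ h1 h2 hu => ?_⟩
      by_contra hne
      rw [not_or] at hne
      exact hcon ⟨V₁, V₂, h1, h2, hu, hne⟩
    obtain ⟨V₁, V₂, h1, h2, hu, hn1, hn2⟩ := this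
    obtain ⟨C₁, c1, d1, e1⟩ := ih V₁ h1 ((hu ▸ Set.subset_union_left).ssubset_of_ne hn1)
    obtain ⟨C₂, -, d2, e2⟩ := ih V₂ h2 ((hu ▸ Set.subset_union_right).ssubset_of_ne hn2)
    refine ⟨C₁ ++ C₂, by simp [c1], fun W hW => ?_, ?_⟩
    · rcases List.mem_append.1 hW with h | h
      exacts [d1 W h, d2 W h]
    · rw [hu, e1, e2]
      ext x
      simp [or_and_right, exists_or]

theorem IsVariety.exists_components {n : ℕ} {V : Set (Fin n → ℝ)} (hV : IsVariety V) :
    ∃ C, IsComponents V C := by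
  classical
  have hex : ∃ m, ∃ C : List (Set (Fin n → ℝ)), C.length = m ∧ C ≠ [] ∧ (∀ W ∈ C, IsIrred W) ∧
      V = {x | ∃ W ∈ C, x ∈ W} := by
    obtain ⟨C, hC⟩ := hV.exists_irred_cover
    exact ⟨_, C, rfl, hC⟩
  -- Take an irreducible cover of minimal length: a member contained in another could be erased.
  obtain ⟨C, hlen, hne, hirr, hu⟩ := Nat.find_spec hex
  have hdrop : ∀ i j : ℕ, ∀ (hi : i < C.length) (hj : j < C.length), i ≠ j → ¬ C[i] ⊆ C[j] := by
    intro i j hi hj hij hsub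
    have hmem : C[j] ∈ C.eraseIdx i := List.mem_eraseIdx_iff_getElem.2 ⟨j, hj, hij.symm, rfl⟩
    refine Nat.find_min hex (m := (C.eraseIdx i).length) ?_
      ⟨C.eraseIdx i, rfl, List.ne_nil_of_mem hmem,
        fun W hW => hirr W (List.mem_of_mem_eraseIdx hW), ?_⟩
    · rw [← hlen, List.length_eraseIdx_of_lt hi]
      omega
    · rw [hu]
      ext x
      constructor
      · rintro ⟨W, hW, hx⟩
        obtain ⟨k, hk, rfl⟩ := List.getElem_of_mem hW
        by_cases hki : k = i
        · subst hki
          exact ⟨_, hmem, hsub hx⟩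
        · exact ⟨C[k], List.mem_eraseIdx_iff_getElem.2 ⟨k, hk, hki, rfl⟩, hx⟩
      · rintro ⟨W, hW, hx⟩
        exact ⟨W, List.mem_of_mem_eraseIdx hW, hx⟩
  refine ⟨C, hne, hirr, hu, ?_⟩
  rw [List.pairwise_iff_getElem]
  intro i j hi hj hij
  exact ⟨hdrop i j hi hj hij.ne, hdrop j i hj hi hij.ne'⟩

/-! ### Termination and output of the algorithm -/

/-- Thanks to `dim ∅ = 0` the empty variety never enters the recursive branch, where nonemptiness is
needed. -/
theorem nonempty_of_dim_ne_zero {n : ℕ} {V : Set (Fin n → ℝ)} (h : dim V ≠ 0) : V.Nonempty := by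
  rw [Set.nonempty_iff_ne_empty]
  rintro rfl
  refine h ?_
  have : {k | ∃ a, IsSubmanifoldAt (∅ : Set (Fin n → ℝ)) a k} = ∅ := by
    ext k
    simp [IsSubmanifoldAt]
  rw [dim, this]
  simp

/-- Separates the pass along the list from the recursion on varieties. The hypothesis ranges over
all `A` and `B` because each call starts from the current state. -/
theorem exists_loop_of_forall {n : ℕ} (L : List (Set (Fin n → ℝ)))
    (hL : ∀ U ∈ L, dim U ≠ 0 → ∀ A B, ∃ C A₁ B₁, IsComponents (singularLocus U) C ∧
      Loop C (A ∪ {W | W ∈ C}) B A₁ B₁) (A B : Set (Set (Fin n → ℝ))) :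
    ∃ A' B', Loop L A B A' B' := by
  induction L generalizing A B with
  | nil => exact ⟨A, B, Loop.nil A B⟩
  | cons U L ih =>
    have ih' := ih fun W hW => hL W (List.mem_cons_of_mem _ hW)
    by_cases h0 : dim U = 0
    · obtain ⟨A', B', h⟩ := ih' (A \ {U}) (B ∪ {U})
      exact ⟨A', B', Loop.zeroDim _ _ _ _ _ _ h0 h⟩
    · obtain ⟨C, A₁, B₁, hC, h₁⟩ := hL U List.mem_cons_self h0 A B
      obtain ⟨A', B', h⟩ := ih' A₁ B₁
      exact ⟨A', B', Loop.posDim _ _ _ _ _ _ _ _ _ h0 hC h₁ h⟩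

/-- Noetherian induction applies because the components of the singular locus are properly contained
in `U`. -/
theorem IsIrred.exists_recursive_call {n : ℕ} {U : Set (Fin n → ℝ)} (hU : IsIrred U)
    (h0 : dim U ≠ 0) (A B : Set (Set (Fin n → ℝ))) :
    ∃ C A₁ B₁, IsComponents (singularLocus U) C ∧ Loop C (A ∪ {W | W ∈ C}) B A₁ B₁ := by
  refine IsVariety.induction (P := fun U => IsIrred U → dim U ≠ 0 → ∀ A B,
    ∃ C A₁ B₁, IsComponents (singularLocus U) C ∧ Loop C (A ∪ {W | W ∈ C}) B A₁ B₁)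
    (fun U _ ih hU h0 A B => ?_) hU.1 hU h0 A B
  have hne := nonempty_of_dim_ne_zero h0
  obtain ⟨C, hC⟩ := (hU.isVariety_singularLocus hne).exists_components
  have hlt : ∀ W ∈ C, W ⊂ U := fun W hW => by
    refine lt_of_le_of_lt (b := singularLocus U) ?_
      (Set.sdiff_subset.ssubset_of_ne (hU.singularLocus_ne hne))
    rw [hC.2.2.1]
    exact fun x hx => ⟨W, hW, hx⟩
  obtain ⟨A₁, B₁, h⟩ := exists_loop_of_forall C
    (fun W hW => ih W (hC.2.1 W hW).1 (hlt W hW) (hC.2.1 W hW)) (A ∪ {W | W ∈ C}) B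
  exact ⟨C, A₁, B₁, hC, h⟩

theorem IsVariety.exists_output {n : ℕ} {V : Set (Fin n → ℝ)} (hV : IsVariety V) :
    ∃ A B, IsOutput V A B := by
  obtain ⟨C, hC⟩ := hV.exists_components
  obtain ⟨A, B, h⟩ := exists_loop_of_forall C
    (fun U hU h0 A B => (hC.2.1 U hU).exists_recursive_call h0 A B) {W | W ∈ C} ∅
  exact ⟨A, B, C, hC, h⟩

/-- Only zero-dimensional varieties are ever deleted from `A`, and nothing is deleted from `B`. What
a recursive call finds therefore survives to the final output. -/
theorem Loop.subset {n : ℕ} {L : List (Set (Fin n → ℝ))} {A B A' B' : Set (Set (Fin n → ℝ))}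
    (h : Loop L A B A' B') : (∀ U ∈ A, dim U ≠ 0 → U ∈ A') ∧ B ⊆ B' := by
  induction h with
  | nil A B => exact ⟨fun U hU _ => hU, subset_rfl⟩
  | zeroDim U L A B A' B' h0 _ ih =>
    refine ⟨fun W hW hd => ih.1 W ⟨hW, ?_⟩ hd, fun W hW => ih.2 (Or.inl hW)⟩
    rintro rfl
    exact hd h0
  | posDim U L C A B A₁ B₁ A' B' _ _ _ _ ih₁ ih₂ =>
    exact ⟨fun W hW hd => ih₂.1 W (ih₁.1 W (Or.inl hW) hd) hd, ih₁.2.trans ih₂.2⟩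

/-- If the list treated by the algorithm has a member on which `x` minimizes `f`, then the output
contains a positive-dimensional variety with `x` a minimizer in its regular locus or a
zero-dimensional variety with `x` a minimizer. -/
theorem Loop.exists_minimizer {n : ℕ} {f : MvPolynomial (Fin n) ℝ} {x : Fin n → ℝ}
    {L : List (Set (Fin n → ℝ))} {A B A' B' : Set (Set (Fin n → ℝ))} (h : Loop L A B A' B')
    (hirr : ∀ U ∈ L, IsIrred U) (hA : ∀ U ∈ L, dim U ≠ 0 → U ∈ A) {U : Set (Fin n → ℝ)}
    (hU : U ∈ L) (hx : x ∈ U)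
    (hmin : ∀ y ∈ U, MvPolynomial.eval x f ≤ MvPolynomial.eval y f) :
    (∃ W ∈ A', dim W ≠ 0 ∧ IsIrred W ∧ x ∈ regularLocus W ∧
      ∀ y ∈ W, MvPolynomial.eval x f ≤ MvPolynomial.eval y f) ∨
    (∃ W ∈ B', dim W = 0 ∧ IsIrred W ∧ x ∈ W ∧
      ∀ y ∈ W, MvPolynomial.eval x f ≤ MvPolynomial.eval y f) := by
  induction h generalizing U with
  | nil A B => simp at hU
  | zeroDim U₀ L A B A' B' h0 hloop ih =>
    have hirr' : ∀ W ∈ L, IsIrred W := fun W hW => hirr W (List.mem_cons_of_mem _ hW)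
    rcases List.mem_cons.1 hU with rfl | hUL
    · exact Or.inr ⟨U, hloop.subset.2 (Or.inr rfl), h0, hirr U List.mem_cons_self, hx, hmin⟩
    · refine ih hirr' (fun W hW hd => ⟨hA W (List.mem_cons_of_mem _ hW) hd, ?_⟩) hUL hx hmin
      rintro rfl
      exact hd h0
  | posDim U₀ L C A B A₁ B₁ A' B' h0 hC hloop₁ hloop₂ ih₁ ih₂ =>
    have hirr' : ∀ W ∈ L, IsIrred W := fun W hW => hirr W (List.mem_cons_of_mem _ hW)
    have hkeep : ∀ W ∈ A, dim W ≠ 0 → W ∈ A₁ := fun W hW hd => hloop₁.subset.1 W (Or.inl hW) hd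
    rcases List.mem_cons.1 hU with rfl | hUL
    · by_cases hreg : x ∈ regularLocus U
      · exact Or.inl ⟨U, hloop₂.subset.1 U (hkeep U (hA U List.mem_cons_self h0) h0) h0, h0,
          hirr U List.mem_cons_self, hreg, hmin⟩
      · have hxs : x ∈ singularLocus U := ⟨hx, hreg⟩
        rw [hC.2.2.1] at hxs
        obtain ⟨W, hWC, hxW⟩ := hxs
        have hWU : W ⊆ U := fun y hy => by
          have : y ∈ singularLocus U := by rw [hC.2.2.1]; exact ⟨W, hWC, hy⟩
          exact this.1
        -- The minimizer lies on a component of the singular locus and still minimizes on this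
        -- smaller set, so the recursive call supplies the required variety.
        rcases ih₁ hC.2.1 (fun W hW _ => Or.inr hW) hWC hxW (fun y hy => hmin y (hWU hy)) with
          ⟨Z, hZ, hd, hrest⟩ | ⟨Z, hZ, hrest⟩
        · exact Or.inl ⟨Z, hloop₂.subset.1 Z hZ hd, hd, hrest⟩
        · exact Or.inr ⟨Z, hloop₂.subset.2 hZ, hrest⟩
    · exact ih₂ hirr' (fun W hW hd => hkeep W (hA W (List.mem_cons_of_mem _ hW) hd) hd) hUL hx hmin

end RealVariety

theorem mainTheorem5 {n l : ℕ} (h₀ : MvPolynomial (Fin n) ℝ)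
    (h : Fin l → MvPolynomial (Fin n) ℝ) (x : Fin n → ℝ)
    (hx : RealVariety.IsGlobalMinimizer h₀ h x) :
    (∃ A B : Set (Set (Fin n → ℝ)), RealVariety.IsOutput (RealVariety.zeroSet h) A B) ∧
    ∀ A B : Set (Set (Fin n → ℝ)), RealVariety.IsOutput (RealVariety.zeroSet h) A B →
      (∃ U ∈ A,
        (∃ (r : ℕ) (q : Fin r → MvPolynomial (Fin n) ℝ),
          RealVariety.Generates q U ∧ RealVariety.zeroSet q = U) ∧
        ∀ (r : ℕ) (q : Fin r → MvPolynomial (Fin n) ℝ), RealVariety.Generates q U →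
          RealVariety.IsGlobalMinimizer h₀ q x ∧ RealVariety.KKT h₀ q x) ∨
      (∃ U ∈ B, RealVariety.dim U = 0 ∧
        ∃ (r : ℕ) (q : Fin r → MvPolynomial (Fin n) ℝ),
          U = RealVariety.zeroSet q ∧ RealVariety.IsGlobalMinimizer h₀ q x) := by
  refine ⟨RealVariety.IsVariety.exists_output ⟨l, h, rfl⟩, ?_⟩
  rintro A B ⟨C, hC, hloop⟩
  obtain ⟨hxV, hmin⟩ := hx
  have hCV := hC.2.2.1
  have hxC := hxV
  rw [hCV] at hxC
  obtain ⟨U, hUC, hxU⟩ := hxC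
  have hminU : ∀ y ∈ U, MvPolynomial.eval x h₀ ≤ MvPolynomial.eval y h₀ := fun y hy =>
    hmin y (by rw [hCV]; exact ⟨U, hUC, hy⟩)
  rcases hloop.exists_minimizer hC.2.1 (fun W hW _ => hW) hUC hxU hminU with
    ⟨W, hWA, -, hW, hreg, hminW⟩ | ⟨W, hWB, hd, hW, hxW, hminW⟩
  · refine Or.inl ⟨W, hWA, ?_, fun r q hq => ⟨?_, hW.kkt hreg hminW hq⟩⟩
    · obtain ⟨r, q, hq⟩ := RealVariety.exists_generates W
      exact ⟨r, q, hq, hW.1.zeroSet_eq hq⟩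
    · rw [RealVariety.IsGlobalMinimizer, hW.1.zeroSet_eq hq]
      exact ⟨hreg.1, hminW⟩
  · obtain ⟨r, q, hq⟩ := hW.1
    exact Or.inr ⟨W, hWB, hd, r, q, hq, by rw [← hq]; exact hxW, by rw [← hq]; exact hminW⟩
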